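/- Let $\mathbf{H}^3$ be hyperbolic $3$-space, on which $\mathrm{PSL}_2(\mathbf{C})$ acts as the group of orientation-preserving isometries. An element $g\in\mathrm{PSL}_2(\mathbf{C})$ (whose trace is defined up to sign) is *loxodromic* if $\mathrm{tr}\,g\in\mathbf{C}\setminus[-2,2]$ and *hyperbolic* if $\mathrm{tr}\,g\in\mathbf{R}\setminus[-2,2]$. A loxodromic element $g$ acts on $\mathbf{H}^3$ by translating along, and possibly rotating around, a unique geodesic line $A_g$, its axis. A lattice (discrete subgroup of finite covolume) $\Gamma\subset\mathrm{PSL}_2(\mathbf{C})$ is an *arithmetic Kleinian group* if there are a number field $k$ with exactly one complex place $v$, a quaternion algebra $B$ over $k$ ramified at all real places of $k$, and a maximal order $\mathcal{O}$ of $B$ such that some conjugate of $\Gamma$ in $\mathrm{PSL}_2(\mathbf{C})$ is commensurable with the image $\Gamma^1_{\mathcal{O}}$ in $\mathrm{PSL}_2(\mathbf{C})$ of the group $\mathcal{O}^1$ of elements of $\mathcal{O}^*$ of reduced norm $1$, under an identification $B\otimes_k k_v\cong \mathrm{M}_2(\mathbf{C})$. A *finite area, totally geodesic surface* of $\mathbf{H}^3/\Gamma$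 is the image in $\mathbf{H}^3/\Gamma$ of a totally geodesic hyperplane $P\subset\mathbf{H}^3$ such that $P/\mathrm{Stab}_\Gamma(P)$ has finite area. The closed geodesic associated to a loxodromic $\gamma\in\Gamma$ is the image of $A_\gamma$ in $\mathbf{H}^3/\Gamma$. **Proposition.** Let $\Gamma$ be an arithmetic Kleinian group and let $\gamma\in\Gamma$ be a loxodromic element. If there is no integer $n\geq 1$ such that $\gamma^n$ is hyperbolic, then the closed geodesic associated to $\gamma$ is not contained in any finite area, totally geodesic surface of $\mathbf{H}^3/\Gamma$. -/

import Mathlib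

open scoped Pointwise MatrixGroups TensorProduct NumberField ENNReal ComplexConjugate ComplexOrder
open MeasureTheory Matrix

noncomputable section

namespace HypGeod

/-! ### Hyperbolic 3-space

The hyperboloid model. The real vector space of Hermitian `2 × 2` matrices with the quadratic form
`det` is Minkowski space of signature `(1, 3)`, and hyperbolic 3-space is the sheet of `det = 1`
that consists of the positive definite matrices. -/

/-- Hyperbolic 3-space: positive definite Hermitian `2 × 2` matrices of determinant one. -/
@[ext]
structure H3 where
  mat : Matrix (Fin 2) (Fin 2) ℂ
  posDef : mat.PosDef
  det_eq_one : mat.det = 1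

namespace H3

/-- The Minkowski inner product (the polarization of `det`) of two points of the hyperboloid. -/
def form (x y : H3) : ℝ := (x.mat⁻¹ * y.mat).trace.re / 2

/-- The hyperbolic distance (curvature `-1`): `cosh d(x, y) = ⟨x, y⟩`. -/
instance : Dist H3 := ⟨fun x y => Real.arcosh (form x y)⟩

theorem dist_def (x y : H3) : dist x y = Real.arcosh (form x y) := rfl

/-- Minkowski coordinates. -/
def t (x : H3) : ℝ := ((x.mat 0 0).re + (x.mat 1 1).re) / 2
def u (x : H3) : ℝ := ((x.mat 0 0).re - (x.mat 1 1).re) / 2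
def v (x : H3) : ℝ := (x.mat 0 1).re
def w (x : H3) : ℝ := (x.mat 0 1).im

theorem mat_one_zero (x : H3) : x.mat 1 0 = conj (x.mat 0 1) :=
  (x.posDef.isHermitian.apply 1 0).symm

theorem mat_diag_im (x : H3) (i : Fin 2) : (x.mat i i).im = 0 :=
  Complex.conj_eq_iff_im.mp (x.posDef.isHermitian.apply i i)

theorem mat_diag_pos (x : H3) (i : Fin 2) : 0 < (x.mat i i).re :=
  (Complex.pos_iff.mp (x.posDef.diag_pos (i := i))).1

theorem coord_eq (x : H3) : x.t ^ 2 - x.u ^ 2 - x.v ^ 2 - x.w ^ 2 = 1 := by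
  have h := congrArg Complex.re x.det_eq_one
  rw [Matrix.det_fin_two, mat_one_zero] at h
  simp only [Complex.sub_re, Complex.mul_re, Complex.conj_re, Complex.conj_im, mat_diag_im,
    Complex.one_re] at h
  unfold t u v w
  linarith

theorem t_pos (x : H3) : 0 < x.t := by
  have h0 := mat_diag_pos x 0
  have h1 := mat_diag_pos x 1
  unfold t
  linarith

theorem form_eq (x y : H3) : form x y = x.t * y.t - x.u * y.u - x.v * y.v - x.w * y.w := by
  unfold form
  rw [Matrix.inv_def, x.det_eq_one, Matrix.adjugate_fin_two, Matrix.trace_fin_two]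
  simp only [Ring.inverse_one, one_smul, Matrix.mul_apply, Fin.sum_univ_two]
  simp [mat_one_zero, mat_diag_im]
  unfold t u v w
  ring

theorem coord_ext {x y : H3} (ht : x.t = y.t) (hu : x.u = y.u) (hv : x.v = y.v)
    (hw : x.w = y.w) : x = y := by
  have h00 : x.mat 0 0 = y.mat 0 0 :=
    Complex.ext (by unfold t u at *; linarith) (by simp [mat_diag_im])
  have h11 : x.mat 1 1 = y.mat 1 1 :=
    Complex.ext (by unfold t u at *; linarith) (by simp [mat_diag_im])
  have h01 : x.mat 0 1 = y.mat 0 1 := Complex.ext hv hw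
  have h10 : x.mat 1 0 = y.mat 1 0 := by rw [mat_one_zero, mat_one_zero, h01]
  ext i j
  fin_cases i <;> fin_cases j <;> assumption

/-- The orthogonal complement of a point of the hyperboloid is negative definite. -/
theorem neg_of_orthogonal (y : H3) {a b c d : ℝ}
    (h : a * y.t - b * y.u - c * y.v - d * y.w = 0) : a ^ 2 ≤ b ^ 2 + c ^ 2 + d ^ 2 := by
  have hy := coord_eq y
  have h1 : (a * y.t) ^ 2 ≤ (b ^ 2 + c ^ 2 + d ^ 2) * (y.u ^ 2 + y.v ^ 2 + y.w ^ 2) := by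
    have : a * y.t = b * y.u + c * y.v + d * y.w := by linarith
    rw [this]
    nlinarith [sq_nonneg (b * y.v - c * y.u), sq_nonneg (b * y.w - d * y.u),
      sq_nonneg (c * y.w - d * y.v)]
  have h2 : a ^ 2 * y.t ^ 2 ≤ (b ^ 2 + c ^ 2 + d ^ 2) * y.t ^ 2 := by
    nlinarith [sq_nonneg b, sq_nonneg c, sq_nonneg d]
  exact le_of_mul_le_mul_right h2 (by have := t_pos y; positivity)

theorem form_self (x : H3) : form x x = 1 := by
  rw [form_eq]; linarith [coord_eq x]

theorem form_comm (x y : H3) : form x y = form y x := by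
  rw [form_eq, form_eq]; ring

theorem form_mul_bound (x y z : H3) :
    (form x z - form x y * form y z) ^ 2 ≤ (form x y ^ 2 - 1) * (form y z ^ 2 - 1) := by
  have hx := coord_eq x
  have hy := coord_eq y
  have hz := coord_eq z
  obtain ⟨a, ha⟩ : ∃ a, a = form x y := ⟨_, rfl⟩
  obtain ⟨b, hb⟩ : ∃ b, b = form y z := ⟨_, rfl⟩
  obtain ⟨c, hc⟩ : ∃ c, c = form x z := ⟨_, rfl⟩
  rw [← ha, ← hb, ← hc]
  rw [form_eq] at ha hb hc
  have key : ∀ s : ℝ, 0 ≤ (b ^ 2 - 1) * (s * s) + (-(2 * (c - a * b))) * s + (a ^ 2 - 1) := by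
    intro s
    have h := neg_of_orthogonal y
      (a := (x.t - a * y.t) + s * (z.t - b * y.t)) (b := (x.u - a * y.u) + s * (z.u - b * y.u))
      (c := (x.v - a * y.v) + s * (z.v - b * y.v)) (d := (x.w - a * y.w) + s * (z.w - b * y.w))
      (by linear_combination (-a - s * b) * hy - ha - s * hb)
    have e : (b ^ 2 - 1) * (s * s) + (-(2 * (c - a * b))) * s + (a ^ 2 - 1) =
        ((x.u - a * y.u) + s * (z.u - b * y.u)) ^ 2 + ((x.v - a * y.v) + s * (z.v - b * y.v)) ^ 2
        + ((x.w - a * y.w) + s * (z.w - b * y.w)) ^ 2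
        - ((x.t - a * y.t) + s * (z.t - b * y.t)) ^ 2 := by
      linear_combination hx + (a + s * b) ^ 2 * hy + s ^ 2 * hz + 2 * (a + s * b) * ha
        + 2 * s * (a + s * b) * hb - 2 * s * hc
    linarith
  have hd := discrim_le_zero key
  unfold discrim at hd
  nlinarith

theorem one_le_form (x y : H3) : 1 ≤ form x y := by
  have hx := coord_eq x
  have hy := coord_eq y
  rw [form_eq]
  have hxt := t_pos x
  have hyt := t_pos y
  have cs : (x.u * y.u + x.v * y.v + x.w * y.w) ^ 2 ≤ (x.t ^ 2 - 1) * (y.t ^ 2 - 1) := by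
    have h1 : x.t ^ 2 - 1 = x.u ^ 2 + x.v ^ 2 + x.w ^ 2 := by linarith
    have h2 : y.t ^ 2 - 1 = y.u ^ 2 + y.v ^ 2 + y.w ^ 2 := by linarith
    rw [h1, h2]
    nlinarith [sq_nonneg (x.u * y.v - x.v * y.u), sq_nonneg (x.u * y.w - x.w * y.u),
      sq_nonneg (x.v * y.w - x.w * y.v)]
  have hx1 : 1 ≤ x.t := by nlinarith [sq_nonneg x.u, sq_nonneg x.v, sq_nonneg x.w]
  have hy1 : 1 ≤ y.t := by nlinarith [sq_nonneg y.u, sq_nonneg y.v, sq_nonneg y.w]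
  have h3 : (x.t ^ 2 - 1) * (y.t ^ 2 - 1) ≤ (x.t * y.t - 1) ^ 2 := by
    nlinarith [sq_nonneg (x.t - y.t)]
  have h4 : 0 ≤ x.t * y.t - 1 := by nlinarith
  have := abs_le_of_sq_le_sq' (cs.trans h3) h4
  linarith [this.2]

theorem eq_of_form_eq_one {x y : H3} (h : form x y = 1) : x = y := by
  have hx := coord_eq x
  have hy := coord_eq y
  have h' := h
  rw [form_eq] at h
  have hyt := t_pos y
  have o : (x.t - y.t) * y.t - (x.u - y.u) * y.u - (x.v - y.v) * y.v - (x.w - y.w) * y.w = 0 := by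
    linarith
  have nul : (x.t - y.t) ^ 2 = (x.u - y.u) ^ 2 + (x.v - y.v) ^ 2 + (x.w - y.w) ^ 2 := by
    linarith
  have e : (x.t - y.t) * y.t = (x.u - y.u) * y.u + (x.v - y.v) * y.v + (x.w - y.w) * y.w := by
    linarith
  have cs : ((x.t - y.t) * y.t) ^ 2 ≤ (x.t - y.t) ^ 2 * (y.t ^ 2 - 1) := by
    have h2 : y.t ^ 2 - 1 = y.u ^ 2 + y.v ^ 2 + y.w ^ 2 := by linarith
    rw [e, nul, h2]
    nlinarith [sq_nonneg ((x.u - y.u) * y.v - (x.v - y.v) * y.u),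
      sq_nonneg ((x.u - y.u) * y.w - (x.w - y.w) * y.u),
      sq_nonneg ((x.v - y.v) * y.w - (x.w - y.w) * y.v)]
  have z : (x.t - y.t) ^ 2 = 0 := by nlinarith [sq_nonneg (x.t - y.t)]
  rw [z] at nul
  have zt := pow_eq_zero_iff (two_ne_zero) |>.mp z
  have zu : x.u - y.u = 0 := by
    refine pow_eq_zero_iff (two_ne_zero) |>.mp ?_
    nlinarith [sq_nonneg (x.u - y.u), sq_nonneg (x.v - y.v), sq_nonneg (x.w - y.w)]
  have zv : x.v - y.v = 0 := by
    refine pow_eq_zero_iff (two_ne_zero) |>.mp ?_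
    nlinarith [sq_nonneg (x.u - y.u), sq_nonneg (x.v - y.v), sq_nonneg (x.w - y.w)]
  have zw : x.w - y.w = 0 := by
    refine pow_eq_zero_iff (two_ne_zero) |>.mp ?_
    nlinarith [sq_nonneg (x.u - y.u), sq_nonneg (x.v - y.v), sq_nonneg (x.w - y.w)]
  exact coord_ext (sub_eq_zero.mp zt) (sub_eq_zero.mp zu) (sub_eq_zero.mp zv) (sub_eq_zero.mp zw)

theorem dist_triangle' (x y z : H3) : dist x z ≤ dist x y + dist y z := by
  have hxy := one_le_form x y
  have hyz := one_le_form y z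
  have hxz := one_le_form x z
  have nn : 0 ≤ dist x y + dist y z :=
    add_nonneg (Real.arcosh_nonneg hxy) (Real.arcosh_nonneg hyz)
  rw [← Real.arcosh_cosh nn, dist_def x z,
    Real.arcosh_le_arcosh (by linarith) (Real.cosh_pos _), Real.cosh_add, dist_def, dist_def,
    Real.cosh_arcosh hxy, Real.cosh_arcosh hyz, Real.sinh_arcosh hxy, Real.sinh_arcosh hyz,
    ← Real.sqrt_mul (by nlinarith)]
  have := Real.le_sqrt_of_sq_le (form_mul_bound x y z)
  linarith

instance : MetricSpace H3 where
  dist_self x := by rw [dist_def, form_self]; exact (Real.arcosh_eq_zero_iff le_rfl).mpr rfl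
  dist_comm x y := by rw [dist_def, dist_def, form_comm]
  dist_triangle := dist_triangle'
  eq_of_dist_eq_zero {x y} h := eq_of_form_eq_one ((Real.arcosh_eq_zero_iff (one_le_form x y)).mp h)

instance : MeasurableSpace H3 := borel H3
instance : BorelSpace H3 := ⟨rfl⟩

/-! ### The action of `PSL(2, ℂ)` by orientation-preserving isometries, `g • x = g x g*` -/

instance : MulAction SL(2, ℂ) H3 where
  smul g x :=
    { mat := g.1 * x.mat * (g.1)ᴴ
      posDef := (Matrix.IsUnit.posDef_star_right_conjugate_iff
        ((Matrix.isUnit_iff_isUnit_det _).mpr (by rw [g.2]; exact isUnit_one))).mpr x.posDef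
      det_eq_one := by
        rw [Matrix.det_mul, Matrix.det_mul, Matrix.det_conjTranspose, g.2, x.det_eq_one]; simp }
  one_smul x := H3.ext (by
    change (1 : Matrix (Fin 2) (Fin 2) ℂ) * x.mat * 1ᴴ = x.mat
    simp)
  mul_smul g h x := H3.ext (by
    change (g.1 * h.1) * x.mat * (g.1 * h.1)ᴴ = g.1 * (h.1 * x.mat * (h.1)ᴴ) * (g.1)ᴴ
    simp [Matrix.mul_assoc])

theorem sl_smul_mat (g : SL(2, ℂ)) (x : H3) : (g • x).mat = g.1 * x.mat * (g.1)ᴴ := rfl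

theorem center_smul {g : SL(2, ℂ)} (hg : g ∈ Subgroup.center SL(2, ℂ)) (x : H3) : g • x = x := by
  obtain ⟨r, hr, hs⟩ := Matrix.SpecialLinearGroup.mem_center_iff.mp hg
  have hr2 : r ^ 2 = 1 := by simpa using hr
  have hr3 : r * conj r = 1 := by
    rcases eq_or_eq_neg_of_sq_eq_sq r 1 (by rw [hr2, one_pow]) with rfl | rfl <;> simp
  apply H3.ext
  rw [sl_smul_mat, ← hs]
  ext i j
  simp [Matrix.scalar_apply]
  linear_combination (x.mat i j) * hr3

/-- The homomorphism from `PSL(2, ℂ)` to the permutations of hyperbolic 3-space. -/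
def pslToPerm : PSL(2, ℂ) →* Equiv.Perm H3 :=
  QuotientGroup.lift _ (MulAction.toPermHom SL(2, ℂ) H3)
    (fun _ hg => Equiv.ext fun x => center_smul hg x)

instance : MulAction PSL(2, ℂ) H3 := MulAction.compHom H3 pslToPerm

theorem psl_smul_mk (g : SL(2, ℂ)) (x : H3) : (QuotientGroup.mk g : PSL(2, ℂ)) • x = g • x := rfl

end H3

/-! ### Loxodromic and hyperbolic elements

The trace of an element of `PSL(2, ℂ)` is defined up to sign. -/

/-- The trace of `g` lies outside the real interval `[-2, 2]`. -/
def IsLoxodromic (g : PSL(2, ℂ)) : Prop :=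
  ∃ M : SL(2, ℂ), (QuotientGroup.mk M : PSL(2, ℂ)) = g ∧
    ¬ ∃ r : ℝ, r ∈ Set.Icc (-2 : ℝ) 2 ∧ M.1.trace = (r : ℂ)

/-- The trace of `g` is real and lies outside the interval `[-2, 2]`. -/
def IsHyperbolic (g : PSL(2, ℂ)) : Prop :=
  ∃ M : SL(2, ℂ), (QuotientGroup.mk M : PSL(2, ℂ)) = g ∧
    ∃ r : ℝ, r ∉ Set.Icc (-2 : ℝ) 2 ∧ M.1.trace = (r : ℂ)

/-- The axis of `g`: the points on a complete geodesic along which `g` acts as a translation by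
a positive distance (a loxodromic element has exactly one such geodesic). -/
def axis (g : PSL(2, ℂ)) : Set H3 :=
  {x | ∃ c : ℝ → H3, Isometry c ∧ x ∈ Set.range c ∧ ∃ τ : ℝ, 0 < τ ∧ ∀ s, g • c s = c (s + τ)}

/-! ### Lattices and arithmetic Kleinian groups -/

/-- A group with finite covolume on `H3`; the volume is the three-dimensional Hausdorff measure
of the hyperbolic metric. -/
def HasFiniteCovolume (Γ : Subgroup PSL(2, ℂ)) : Prop :=
  ∃ F : Set H3, IsFundamentalDomain Γ F (μH[3] : Measure H3) ∧ (μH[3] : Measure H3) F < ∞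

/-- A lattice in `PSL(2, ℂ)`: a discrete subgroup of finite covolume. -/
def IsLattice (Γ : Subgroup PSL(2, ℂ)) : Prop :=
  DiscreteTopology Γ ∧ HasFiniteCovolume Γ

section Quaternion

variable (k : Type) [Field k] [NumberField k] (B : Type) [Ring B] [Algebra k B]

/-- A quaternion algebra over `k`: a central simple algebra of dimension four. -/
structure IsQuaternionAlgebra : Prop where
  central : Algebra.IsCentral k B
  simple : IsSimpleRing B
  finrank_eq : Module.finrank k B = 4

/-- `B` ramifies at the real place given by `σ`: the base change of `B` along `σ : k → ℝ` is a
division algebra. -/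
def RamifiesAtReal (σ : k →+* ℝ) : Prop :=
  letI : Algebra k ℝ := σ.toAlgebra
  ∀ x : ℝ ⊗[k] B, x ≠ 0 → IsUnit x

/-- The type of identifications of the base change of `B` along `φ : k → ℂ` with `M₂(ℂ)`. -/
def Splitting (φ : k →+* ℂ) : Type :=
  letI : Algebra k ℂ := φ.toAlgebra
  (ℂ ⊗[k] B) ≃ₐ[ℂ] Matrix (Fin 2) (Fin 2) ℂ

variable {k B}

/-- The embedding of `B` into `M₂(ℂ)` given by an identification of its base change. -/
def Splitting.toMatrix {φ : k →+* ℂ} (e : Splitting k B φ) : B →+* Matrix (Fin 2) (Fin 2) ℂ :=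
  letI : Algebra k ℂ := φ.toAlgebra
  (AlgEquiv.toRingEquiv (R := ℂ) e : ℂ ⊗[k] B →+* Matrix (Fin 2) (Fin 2) ℂ).comp
    (Algebra.TensorProduct.includeRight : B →ₐ[k] ℂ ⊗[k] B).toRingHom

/-- An order of `B`: a subring containing `𝓞 k` which is finitely generated as an `𝓞 k`-module and
spans `B` over `k`. -/
def IsOrder (O : Subalgebra (𝓞 k) B) : Prop :=
  (Subalgebra.toSubmodule O).FG ∧ Submodule.span k (O : Set B) = ⊤

/-- A maximal order of `B`. -/
def IsMaximalOrder (O : Subalgebra (𝓞 k) B) : Prop :=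
  Maximal IsOrder O

/-- The image in `PSL(2, ℂ)` of the group `O¹` of units of `O` of reduced norm one. The reduced
norm of `b` is the determinant of its image in `M₂(ℂ)`, so a unit has reduced norm one exactly
when its image lies in `SL(2, ℂ)`. -/
def normOneImage {φ : k →+* ℂ} (e : Splitting k B φ) (O : Subalgebra (𝓞 k) B) :
    Subgroup PSL(2, ℂ) where
  carrier := {g | ∃ (b : Oˣ) (M : SL(2, ℂ)),
    M.1 = e.toMatrix ((b : O) : B) ∧ (QuotientGroup.mk M : PSL(2, ℂ)) = g}
  one_mem' := ⟨1, 1, by simp, rfl⟩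
  mul_mem' := by
    rintro _ _ ⟨a, M, hM, rfl⟩ ⟨b, N, hN, rfl⟩
    exact ⟨a * b, M * N, by simp [hM, hN], rfl⟩
  inv_mem' := by
    rintro _ ⟨a, M, hM, rfl⟩
    refine ⟨a⁻¹, M⁻¹, ?_, rfl⟩
    have h1 : M.1 * e.toMatrix ((a⁻¹ : Oˣ) : O) = 1 := by
      rw [hM, ← map_mul, ← MulMemClass.coe_mul, Units.mul_inv]
      simp
    have h2 : (M⁻¹ : SL(2, ℂ)).1 * M.1 = 1 := congrArg Subtype.val (inv_mul_cancel M)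
    calc (M⁻¹ : SL(2, ℂ)).1 = (M⁻¹ : SL(2, ℂ)).1 * (M.1 * e.toMatrix ((a⁻¹ : Oˣ) : O)) := by
          rw [h1, mul_one]
      _ = _ := by rw [← mul_assoc, h2, one_mul]

end Quaternion

/-- An arithmetic Kleinian group: a lattice in `PSL(2, ℂ)` which is commensurable in the wide sense
(that is, after conjugation in `PSL(2, ℂ)`) with the image of `O¹`, for a maximal order `O` of a
quaternion algebra `B` over a number field `k` with exactly one complex place such that `B`
ramifies at all real places of `k`. The complex place is given by a non-real embedding `φ`. -/
def IsArithmeticKleinian (Γ : Subgroup PSL(2, ℂ)) : Prop :=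
  IsLattice Γ ∧
  ∃ (k : Type) (_ : Field k) (_ : NumberField k) (B : Type) (_ : Ring B) (_ : Algebra k B)
    (φ : k →+* ℂ) (e : Splitting k B φ) (O : Subalgebra (𝓞 k) B) (g : PSL(2, ℂ)),
    NumberField.InfinitePlace.nrComplexPlaces k = 1 ∧
    ¬ NumberField.ComplexEmbedding.IsReal φ ∧
    IsQuaternionAlgebra k B ∧
    (∀ σ : k →+* ℝ, RamifiesAtReal k B σ) ∧
    IsMaximalOrder O ∧
    Subgroup.Commensurable (ConjAct.toConjAct g • Γ) (normOneImage e O)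

/-! ### Totally geodesic surfaces in the quotient -/

/-- The quotient `H³/Γ`. -/
abbrev Orbifold (Γ : Subgroup PSL(2, ℂ)) : Type := MulAction.orbitRel.Quotient Γ H3

/-- The projection `H³ → H³/Γ`. -/
def proj (Γ : Subgroup PSL(2, ℂ)) (x : H3) : Orbifold Γ := Quotient.mk _ x

/-- Totally geodesic hyperplanes of `H³`: the intersections of the hyperboloid with the hyperplanes
`{x | tr (N x) = 0}` of Minkowski space that are orthogonal to a space-like vector. -/
def IsHyperplane (P : Set H3) : Prop :=
  ∃ N : Matrix (Fin 2) (Fin 2) ℂ, N.IsHermitian ∧ N.det.re < 0 ∧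
    P = {x | (N * x.mat).trace = 0}

/-- The surface `P / Stab_Γ(P)` has finite area; the area on `P` is the two-dimensional Hausdorff
measure of the hyperbolic metric. -/
def HasFiniteArea (Γ : Subgroup PSL(2, ℂ)) (P : Set H3) : Prop :=
  ∃ F : Set H3, IsFundamentalDomain (MulAction.stabilizer Γ P) F ((μH[2] : Measure H3).restrict P) ∧
    ((μH[2] : Measure H3).restrict P) F < ∞

/-- `S` is (the point set in `H³/Γ` of) a finite area totally geodesic surface of `H³/Γ`: the
image of a totally geodesic hyperplane `P` whose quotient `P / Stab_Γ(P)` has finite area. -/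
def IsFiniteAreaTotallyGeodesicSurface (Γ : Subgroup PSL(2, ℂ)) (S : Set (Orbifold Γ)) : Prop :=
  ∃ P : Set H3, IsHyperplane P ∧ HasFiniteArea Γ P ∧ S = proj Γ '' P

/-- The closed geodesic of `H³/Γ` associated to `γ`: the image of the axis of `γ`. -/
def associatedGeodesic (Γ : Subgroup PSL(2, ℂ)) (γ : PSL(2, ℂ)) : Set (Orbifold Γ) :=
  proj Γ '' axis γ

end HypGeod

end

noncomputable section

namespace HypGeod

namespace H3

/-! ### The action by isometries -/

/-! Suppose the closed geodesic of `γ` lies in the image of a finite area plane `P`. Each point of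
the axis is moved into `P` by some element of `Γ`; since `Γ` is countable and the axis is not, one
element `g` moves two points of the axis into `P`. After replacing `γ` by its conjugate under `g`,
the plane meets the axis twice and hence contains it (`exists_mem_axialPlane_iff`).

Finite area now forces some power `γ ^ n` with `n ≥ 1` to preserve `P`
(`exists_pow_smul_eq_of_finite_area`). The discs of radius `1/2` in `P` around the points `γ⁻ⁿ x` of
the axis all have the same positive area. If no such power preserved `P`, the elements `g γ⁻ⁿ` with
`g` in the stabilizer would be pairwise distinct, so proper discontinuity would bound the number of
translated discs through any point. The total area of infinitely many equal discs would then be at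
most a finite multiple of the area of the quotient.

Finally, an element that preserves a plane through its axis rotates around that axis by a multiple
of `π`, so the square of its eigenvalue is real (`exists_sq_eq_ofReal`), and `γ ^ (2 * n)` is
hyperbolic. -/

theorem form_smul (g : SL(2, ℂ)) (x y : H3) : form (g • x) (g • y) = form x y := by
  have hg : IsUnit g.1.det := by rw [g.2]; exact isUnit_one
  have hg' : IsUnit (g.1)ᴴ.det := by rw [Matrix.det_conjTranspose, g.2]; simp
  unfold form
  rw [sl_smul_mat, sl_smul_mat, Matrix.mul_inv_rev, Matrix.mul_inv_rev]
  have : (g.1)ᴴ⁻¹ * (x.mat⁻¹ * g.1⁻¹) * (g.1 * y.mat * (g.1)ᴴ) =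
      (g.1)ᴴ⁻¹ * (x.mat⁻¹ * y.mat * (g.1)ᴴ) := by
    calc _ = (g.1)ᴴ⁻¹ * (x.mat⁻¹ * (g.1⁻¹ * g.1) * y.mat * (g.1)ᴴ) := by
          simp only [Matrix.mul_assoc]
      _ = _ := by rw [Matrix.nonsing_inv_mul _ hg, Matrix.mul_one]
  rw [this, Matrix.trace_mul_comm, Matrix.mul_assoc, Matrix.mul_nonsing_inv _ hg', Matrix.mul_one]

instance : IsIsometricSMul SL(2, ℂ) H3 :=
  ⟨fun g => Isometry.of_dist_eq fun x y => by rw [dist_def, dist_def, form_smul]⟩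

instance : IsIsometricSMul PSL(2, ℂ) H3 :=
  ⟨fun g => by
    induction g using QuotientGroup.induction_on with
    | H g => exact isometry_smul H3 g⟩

instance {G X : Type*} [Group G] [PseudoEMetricSpace X] [MulAction G X] [IsIsometricSMul G X]
    (H : Subgroup G) : IsIsometricSMul H X :=
  ⟨fun g => isometry_smul X (g : G)⟩

/-- The base point of hyperbolic space: the identity matrix. -/
def origin : H3 := ⟨1, Matrix.PosDef.one, Matrix.det_one⟩

theorem form_origin_smul_origin (g : SL(2, ℂ)) :
    form origin (g • origin) = (∑ i, ∑ j, ‖g.1 i j‖ ^ 2) / 2 := by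
  unfold form
  rw [sl_smul_mat]
  simp [origin, Matrix.trace_fin_two, Matrix.mul_apply, Fin.sum_univ_two, Complex.mul_conj,
    Complex.sq_norm]

/-! ### Discrete groups act properly discontinuously -/

/-- The displacement of the base point controls the Frobenius norm, by `form_origin_smul_origin`.
This is what makes the action proper. -/
theorem norm_entry_le_of_dist_le {g : SL(2, ℂ)} {R : ℝ} (hg : dist origin (g • origin) ≤ R)
    (i j : Fin 2) : ‖g.1 i j‖ ≤ 2 * Real.cosh R := by
  have h1 := one_le_form origin (g • origin)
  have h0 : 0 ≤ dist origin (g • origin) := dist_nonneg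
  have h2 : form origin (g • origin) ≤ Real.cosh R := by
    rw [← Real.cosh_arcosh h1, Real.cosh_le_cosh, ← dist_def, abs_of_nonneg h0,
      abs_of_nonneg (h0.trans hg)]
    exact hg
  rw [form_origin_smul_origin] at h2
  have h3 : ‖g.1 i j‖ ^ 2 ≤ ∑ i, ∑ j, ‖g.1 i j‖ ^ 2 :=
    (Finset.single_le_sum (f := fun j => ‖g.1 i j‖ ^ 2) (fun _ _ => sq_nonneg _)
      (Finset.mem_univ j)).trans
    (Finset.single_le_sum (f := fun i => ∑ j, ‖g.1 i j‖ ^ 2)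
      (fun _ _ => Finset.sum_nonneg fun _ _ => sq_nonneg _) (Finset.mem_univ i))
  have h4 := Real.one_le_cosh R
  refine abs_le_of_sq_le_sq' (a := ‖g.1 i j‖) ?_ (by linarith) |>.2
  nlinarith

theorem isClosedEmbedding_slVal :
    Topology.IsClosedEmbedding (Subtype.val : SL(2, ℂ) → Matrix (Fin 2) (Fin 2) ℂ) :=
  IsClosed.isClosedEmbedding_subtypeVal
    (isClosed_eq (Continuous.matrix_det continuous_id) continuous_const)

theorem isCompact_setOf_norm_entry_le (C : ℝ) :
    IsCompact {g : SL(2, ℂ) | ∀ i j, ‖g.1 i j‖ ≤ C} := by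
  have h : IsCompact (Set.univ.pi fun _ : Fin 2 => Set.univ.pi fun _ : Fin 2 =>
      Metric.closedBall (0 : ℂ) C) :=
    isCompact_univ_pi fun _ => isCompact_univ_pi fun _ => isCompact_closedBall _ _
  have e : {g : SL(2, ℂ) | ∀ i j, ‖g.1 i j‖ ≤ C} = Subtype.val ⁻¹'
      (Set.univ.pi fun _ : Fin 2 => Set.univ.pi fun _ : Fin 2 => Metric.closedBall (0 : ℂ) C) := by
    ext g
    exact ⟨fun hg i _ j _ => mem_closedBall_zero_iff.mpr (hg i j),
      fun hg i j => mem_closedBall_zero_iff.mp (hg i trivial j trivial)⟩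
  rw [e]
  exact isClosedEmbedding_slVal.isCompact_preimage h

instance isClosed_center : IsClosed ((Subgroup.center SL(2, ℂ) : Subgroup SL(2, ℂ)) :
    Set SL(2, ℂ)) := by
  have : ((Subgroup.center SL(2, ℂ) : Subgroup SL(2, ℂ)) : Set SL(2, ℂ)) =
      ⋂ g : SL(2, ℂ), {z | g * z = z * g} := by
    ext z
    simp [Subgroup.mem_center_iff]
  rw [this]
  exact isClosed_iInter fun g => isClosed_eq (by fun_prop) (by fun_prop)

instance : T2Space PSL(2, ℂ) := by
  have : T3Space (SL(2, ℂ) ⧸ Subgroup.center SL(2, ℂ)) := inferInstance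
  exact inferInstanceAs (T2Space (SL(2, ℂ) ⧸ Subgroup.center SL(2, ℂ)))

/-- Elements of bounded displacement come from a compact set of matrices, and a discrete subgroup of
a Hausdorff group meets a compact set in finitely many points. Conjugation by `h` moves the base
point to `h • origin`. -/
theorem finite_setOf_dist_smul_le (Γ : Subgroup PSL(2, ℂ)) [DiscreteTopology Γ] (h : SL(2, ℂ))
    (R : ℝ) : {g : Γ | dist (h • origin) (g • h • origin) ≤ R}.Finite := by
  have hK : IsCompact ((fun g : SL(2, ℂ) => (QuotientGroup.mk (h * g * h⁻¹) : PSL(2, ℂ))) ''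
      {g : SL(2, ℂ) | ∀ i j, ‖g.1 i j‖ ≤ 2 * Real.cosh R}) :=
    (isCompact_setOf_norm_entry_le _).image
      (QuotientGroup.continuous_mk.comp (by fun_prop))
  have hfin := (Γ.tendsto_coe_cofinite_of_discrete ⟨inferInstance⟩) hK.compl_mem_cocompact
  rw [Filter.mem_map, Filter.mem_cofinite] at hfin
  refine hfin.subset fun g hg => ?_
  obtain ⟨g, hgΓ⟩ := g
  induction g using QuotientGroup.induction_on with
  | H M =>
    simp only [Set.mem_compl_iff, Set.mem_preimage, not_not]
    refine ⟨h⁻¹ * M * h, norm_entry_le_of_dist_le (R := R) ?_, by group⟩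
    change dist (h • origin) (M • h • origin) ≤ R at hg
    rwa [← dist_smul h, mul_smul, mul_smul, smul_inv_smul]

theorem countable_of_discrete (Γ : Subgroup PSL(2, ℂ)) [DiscreteTopology Γ] : Countable Γ := by
  rw [← Set.countable_univ_iff]
  have : (Set.univ : Set Γ) =
      ⋃ n : ℕ, {g : Γ | dist ((1 : SL(2, ℂ)) • origin) (g • (1 : SL(2, ℂ)) • origin) ≤ n} := by
    ext g
    simpa using exists_nat_ge _
  rw [this]
  exact Set.countable_iUnion fun n => (finite_setOf_dist_smul_le Γ 1 n).countable

/-! ### Finite area planes -/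

section

variable {X : Type*} [MetricSpace X] [MeasurableSpace X] [BorelSpace X]

theorem smulInvariantMeasure_restrict_stabilizer (G : Type*) [Group G] [MulAction G X]
    [IsIsometricSMul G X] (P : Set X) :
    SMulInvariantMeasure (MulAction.stabilizer G P) X ((μH[2] : Measure X).restrict P) := by
  refine ⟨fun g s hs => ?_⟩
  have hgP : (fun y : X => g • y) ⁻¹' P = P := by
    have h := g⁻¹.2
    rw [MulAction.mem_stabilizer_iff] at h
    have h2 : (fun y : X => g • y) ⁻¹' P = (g⁻¹ : MulAction.stabilizer G P) • P :=
      Set.preimage_smul g P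
    rw [h2]
    exact h
  have hm : Measurable fun y : X => g • y := measurable_const_smul g
  rw [Measure.restrict_apply (hm hs), Measure.restrict_apply hs]
  have h3 : (fun y : X => g • y) ⁻¹' s ∩ P = (fun y : X => g • y) ⁻¹' (s ∩ P) := by
    rw [Set.preimage_inter, hgP]
  rw [h3]
  exact (IsometryEquiv.constSMul g).hausdorffMeasure_preimage _ _

/-- Unfold each `μ (B n)` over the translates of the fundamental domain and exchange sum and
integral: the integrand at `y` counts the translated sets that contain `y`. -/
theorem tsum_measure_le_of_encard_le {Y H ι : Type*} [MeasurableSpace Y] [Group H] [Countable H]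
    [Countable ι] [MulAction H Y] [MeasurableConstSMul H Y] {μ : Measure Y}
    [SMulInvariantMeasure H Y μ]
    {F : Set Y} (hF : IsFundamentalDomain H F μ) {B : ι → Set Y} (hB : ∀ n, MeasurableSet (B n))
    {N : ℕ∞} (hN : ∀ y, {p : ι × H | y ∈ p.2 • B p.1}.encard ≤ N) :
    ∑' n, μ (B n) ≤ N * μ F := by
  let A : ι × H → Set Y := fun p => p.2 • B p.1
  have hA : ∀ p, MeasurableSet (A p) := fun p => (hB p.1).const_smul p.2
  have e : ∀ p y, (A p).indicator (fun _ => (1 : ℝ≥0∞)) y =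
      {p | y ∈ A p}.indicator (fun _ => (1 : ℝ≥0∞)) p := fun p y => by
    by_cases h : y ∈ A p
    · rw [Set.indicator_of_mem h, Set.indicator_of_mem (s := {p | y ∈ A p}) h]
    · rw [Set.indicator_of_notMem h, Set.indicator_of_notMem (s := {p | y ∈ A p}) h]
  calc ∑' n, μ (B n)
      = ∑' n, ∑' g : H, μ (A (n, g) ∩ F) := tsum_congr fun n => hF.measure_eq_tsum (B n)
    _ = ∑' p, μ (A p ∩ F) := (ENNReal.tsum_prod (f := fun n g => μ (A (n, g) ∩ F))).symm
    _ = ∑' p, ∫⁻ y in F, (A p).indicator (fun _ => (1 : ℝ≥0∞)) y ∂μ := by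
        refine tsum_congr fun p => ?_
        rw [lintegral_indicator (hA p), lintegral_one, Measure.restrict_restrict (hA p),
          Measure.restrict_apply_univ]
    _ = ∫⁻ y in F, ∑' p, (A p).indicator (fun _ => (1 : ℝ≥0∞)) y ∂μ :=
        (lintegral_tsum fun p => (measurable_const.indicator (hA p)).aemeasurable).symm
    _ ≤ ∫⁻ _ in F, (N : ℝ≥0∞) ∂μ := by
        refine lintegral_mono fun y => ?_
        simp_rw [e]
        rw [← tsum_subtype, ENNReal.tsum_set_one]
        exact_mod_cast hN y
    _ = N * μ F := by rw [setLIntegral_const]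

/-- If `P` has finite area modulo its stabilizer and the discs in `P` around the points `γ⁻ⁿ x` have
area at least `c`, then a power of `γ` preserves `P`: otherwise these discs would contribute
infinitely much to the area of the quotient. -/
theorem exists_pow_smul_eq_of_finite_area {G : Type*} [Group G] [Countable G] [MulAction G X]
    [IsIsometricSMul G X] {P F : Set X}
    (hF : IsFundamentalDomain (MulAction.stabilizer G P) F ((μH[2] : Measure X).restrict P))
    (hFfin : (μH[2] : Measure X).restrict P F < ∞) (γ : G) (x : X)
    (hfin : {g : G | dist x (g • x) ≤ 1}.Finite) {c : ℝ≥0∞} (hc : c ≠ 0)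
    (hball : ∀ n : ℕ, c ≤ (μH[2] : Measure X) (Metric.ball ((γ ^ n)⁻¹ • x) (1 / 2) ∩ P)) :
    ∃ n : ℕ, 1 ≤ n ∧ γ ^ n • P = P := by
  by_contra! hne
  set μ : Measure X := (μH[2] : Measure X).restrict P with hμ
  have hinv := smulInvariantMeasure_restrict_stabilizer G P
  let B : ℕ → Set X := fun n => Metric.ball ((γ ^ n)⁻¹ • x) (1 / 2)
  have hB : ∀ n, MeasurableSet (B n) := fun n => Metric.isOpen_ball.measurableSet
  set N := {g : G | dist x (g • x) ≤ 1}.encard with hN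
  -- every point lies in at most `N` of the translated balls
  have hmult : ∀ y : X, {p : ℕ × MulAction.stabilizer G P | y ∈ p.2 • B p.1}.encard ≤ N := by
    intro y
    rcases Set.eq_empty_or_nonempty {p : ℕ × MulAction.stabilizer G P | y ∈ p.2 • B p.1} with
      he | ⟨p₀, hp₀⟩
    · rw [he]; simp
    -- The translated ball indexed by `p` is the ball of radius `1/2` around `f p • x`. Counting
    -- balls through `y` thus becomes counting group elements, once `f` is injective.
    let f : ℕ × MulAction.stabilizer G P → G := fun p => (p.2 : G) * (γ ^ p.1)⁻¹
    have hdist : ∀ p : ℕ × MulAction.stabilizer G P, y ∈ p.2 • B p.1 →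
        dist y (f p • x) < 1 / 2 := by
      intro p hp
      obtain ⟨z, hz, rfl⟩ := hp
      change dist ((p.2 : G) • z) _ < _
      rw [mul_smul, dist_smul]
      exact hz
    have hinj : Function.Injective f := by
      have key : ∀ p q : ℕ × MulAction.stabilizer G P, f p = f q → ¬ p.1 < q.1 := by
        intro p q hpq hlt
        apply hne (q.1 - p.1) (by omega)
        have e : γ ^ (q.1 - p.1) = ((p.2 : G))⁻¹ * q.2 := by
          have : γ ^ (q.1 - p.1) = (γ ^ p.1)⁻¹ * γ ^ q.1 := by
            rw [eq_inv_mul_iff_mul_eq, ← pow_add]; congr 1; omega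
          rw [this]
          have hpq' : (p.2 : G) * (γ ^ p.1)⁻¹ = (q.2 : G) * (γ ^ q.1)⁻¹ := hpq
          rw [eq_inv_mul_iff_mul_eq, ← mul_assoc, hpq', inv_mul_cancel_right]
        rw [e]
        exact (p.2⁻¹ * q.2).2
      intro p q hpq
      have h1 : p.1 = q.1 := le_antisymm (not_lt.mp (key q p hpq.symm)) (not_lt.mp (key p q hpq))
      have h2 : (p.2 : G) * (γ ^ p.1)⁻¹ = (q.2 : G) * (γ ^ q.1)⁻¹ := hpq
      rw [h1] at h2
      exact Prod.ext h1 (Subtype.ext (mul_right_cancel h2))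
    -- Two centres within `1/2` of `y` are at distance at most `1`, so after normalizing by one of
    -- them all the elements lie in the finite set of `hfin`.
    have hinj2 : Function.Injective fun p => (f p₀)⁻¹ * f p :=
      (mul_right_injective _).comp hinj
    rw [← hinj2.encard_image]
    refine Set.encard_le_encard ?_
    rintro _ ⟨p, hp, rfl⟩
    change dist x (((f p₀)⁻¹ * f p) • x) ≤ 1
    rw [mul_smul, ← dist_smul (f p₀), smul_inv_smul]
    have h1 := hdist p hp
    have h2 := hdist p₀ hp₀
    have h3 := dist_triangle_left (f p₀ • x) (f p • x) y
    linarith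
  have hsum : ∑' n : ℕ, μ (B n) ≤ N * μ F := tsum_measure_le_of_encard_le hF hB hmult
  have htop : ∑' n : ℕ, μ (B n) = ∞ := by
    refine top_unique ((ENNReal.tsum_const_eq_top_of_ne_zero (α := ℕ) hc).symm.le.trans
      (ENNReal.tsum_le_tsum fun n => ?_))
    rw [hμ, Measure.restrict_apply (hB n)]
    exact hball n
  rw [htop, top_le_iff] at hsum
  refine ENNReal.mul_ne_top ?_ hFfin.ne hsum
  rw [hN, ← hfin.cast_ncard_eq]
  simp

end

/-! ### Discs in totally geodesic planes have positive area -/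

/-- The matrix is `g g*` for an upper triangular `g`, so it is positive definite because it lies in
the orbit of the base point. -/
theorem exists_mat_eq (z : ℂ) {d : ℝ} (hd : 0 < d) :
    ∃ x : H3, x.mat = !![(((1 + ‖z‖ ^ 2) / d : ℝ) : ℂ), z; conj z, (d : ℂ)] := by
  have hs : (0 : ℝ) < Real.sqrt d := Real.sqrt_pos.mpr hd
  have hs' : (Real.sqrt d : ℂ) ≠ 0 := by exact_mod_cast hs.ne'
  have hsq : (Real.sqrt d : ℂ) * (Real.sqrt d : ℂ) = d := by
    exact_mod_cast Real.mul_self_sqrt hd.le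
  let g : SL(2, ℂ) := ⟨!![(Real.sqrt d : ℂ)⁻¹, z / Real.sqrt d; 0, (Real.sqrt d : ℂ)], by
    rw [Matrix.det_fin_two_of]; field_simp; ring⟩
  refine ⟨g • origin, ?_⟩
  rw [sl_smul_mat]
  have hz : z * conj z = ((‖z‖ ^ 2 : ℝ) : ℂ) := by rw [Complex.mul_conj, Complex.sq_norm]
  have hd' : (d : ℂ) ≠ 0 := by exact_mod_cast hd.ne'
  ext i j
  fin_cases i <;> fin_cases j <;>
    simp [origin, g, Matrix.mul_apply, Fin.sum_univ_two, hsq]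
  · rw [← mul_inv, hsq, div_mul_div_comm, hsq, hz]
    push_cast
    field_simp
  · field_simp
  · field_simp

theorem form_origin (x : H3) : form origin x = x.t := by
  simp [form, origin, Matrix.trace_fin_two, t]

theorem dist_origin_lt_half_iff (x : H3) :
    dist origin x < 1 / 2 ↔ x.t < Real.cosh (1 / 2) := by
  have h1 := one_le_form origin x
  have h0 : 0 ≤ dist origin x := dist_nonneg
  rw [← form_origin, ← Real.cosh_arcosh h1, Real.cosh_lt_cosh, ← dist_def, abs_of_nonneg h0,
    abs_of_nonneg (by norm_num)]

theorem cosh_half_lt_two : Real.cosh (1 / 2) < 2 := by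
  have h := Real.cosh_le_exp_half_sq (1 / 2)
  have h2 := Real.abs_exp_sub_one_le (x := (1 / 2 : ℝ) ^ 2 / 2) (by norm_num [abs_of_pos])
  have h3 := le_abs_self (Real.exp ((1 / 2 : ℝ) ^ 2 / 2) - 1)
  rw [abs_of_pos (by norm_num : (0 : ℝ) < (1 / 2) ^ 2 / 2)] at h2
  linarith

theorem sq_inner_le_three (a b c d e f : ℝ) : (a * d + b * e + c * f) ^ 2 ≤
    (a ^ 2 + b ^ 2 + c ^ 2) * (d ^ 2 + e ^ 2 + f ^ 2) := by
  nlinarith [sq_nonneg (a * e - b * d), sq_nonneg (a * f - c * d), sq_nonneg (b * f - c * e)]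

/-- Near the origin the Euclidean distance in Minkowski coordinates is at most a multiple of the
hyperbolic distance. -/
theorem coord_sq_le {x y : H3} (hx : dist origin x < 1 / 2) (hy : dist origin y < 1 / 2) :
    (x.u - y.u) ^ 2 + (x.v - y.v) ^ 2 + (x.w - y.w) ^ 2 ≤ (3 * dist x y) ^ 2 := by
  have hd : dist x y ≤ 1 := by
    have := dist_triangle_left x y origin
    linarith
  have hd0 : 0 ≤ dist x y := dist_nonneg
  rw [dist_origin_lt_half_iff] at hx hy
  have hc := cosh_half_lt_two
  -- This uses `cosh d ≤ exp (d² / 2)` together with `exp s - 1 ≤ 2 s` for `0 ≤ s ≤ 1`.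
  have hf : form x y - 1 ≤ dist x y ^ 2 := by
    have h1 : form x y = Real.cosh (dist x y) := by
      rw [dist_def, Real.cosh_arcosh (one_le_form x y)]
    have h2 := Real.cosh_le_exp_half_sq (dist x y)
    have hn : 0 ≤ dist x y ^ 2 / 2 := by positivity
    have h3 := Real.abs_exp_sub_one_le (x := dist x y ^ 2 / 2)
      (by rw [abs_of_nonneg hn]; nlinarith)
    rw [abs_of_nonneg hn] at h3
    have h4 := le_abs_self (Real.exp (dist x y ^ 2 / 2) - 1)
    linarith
  have hfe := form_eq x y
  have h1f := one_le_form x y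
  have cx := coord_eq x
  have cy := coord_eq y
  have tx := t_pos x
  have ty := t_pos y
  obtain ⟨S, hS⟩ : ∃ S, S = (x.u - y.u) ^ 2 + (x.v - y.v) ^ 2 + (x.w - y.w) ^ 2 := ⟨_, rfl⟩
  obtain ⟨T, hT⟩ : ∃ T, T = x.t + y.t := ⟨_, rfl⟩
  obtain ⟨δ, hδ⟩ : ∃ δ, δ = x.t - y.t := ⟨_, rfl⟩
  obtain ⟨f, hf'⟩ : ∃ f, f = form x y := ⟨_, rfl⟩
  have hS0 : 0 ≤ S := by rw [hS]; positivity
  have e1 : 2 * (f - 1) = S - δ ^ 2 := by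
    rw [hf', hS, hδ]; linear_combination 2 * hfe + cx + cy
  have e2 : (x.u + y.u) ^ 2 + (x.v + y.v) ^ 2 + (x.w + y.w) ^ 2 = T ^ 2 - 2 - 2 * f := by
    rw [hf', hT]; linear_combination -cx - cy + 2 * hfe
  have e3 : δ * T = (x.u - y.u) * (x.u + y.u) + (x.v - y.v) * (x.v + y.v)
      + (x.w - y.w) * (x.w + y.w) := by
    rw [hT, hδ]; linear_combination cx - cy
  -- Cauchy–Schwarz for the spatial parts of `x - y` and `x + y` bounds the time difference `δ`.
  -- With `T ≤ 4` it gives `S ≤ 8 (f - 1)`, which is below `9 d²`.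
  have cs : (δ * T) ^ 2 ≤ S * (T ^ 2 - 2 - 2 * f) := by
    rw [← e2, e3, hS]
    exact sq_inner_le_three _ _ _ _ _ _
  rw [← hf'] at hf h1f
  have hT0 : 0 < T := by rw [hT]; linarith
  have hT4 : T ^ 2 ≤ 16 := by
    have := pow_le_pow_left₀ hT0.le (show T ≤ 4 by linarith) 2
    linarith
  have cs2 : (δ * T) ^ 2 ≤ S * (T ^ 2 - 4) := 
    cs.trans (mul_le_mul_of_nonneg_left (by linarith) hS0)
  have h5 : S * 4 ≤ 2 * (f - 1) * T ^ 2 := by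
    rw [e1]; linarith [cs2, mul_pow δ T 2]
  have h6 : 2 * (f - 1) * T ^ 2 ≤ 2 * (f - 1) * 16 :=
    mul_le_mul_of_nonneg_left hT4 (by linarith)
  rw [← hS, mul_pow]
  linarith [sq_nonneg (dist x y)]

/-- The hyperboloid is a graph over its spatial coordinates. The lower diagonal entry has to be `t -
p`, and `1 + ‖z‖² = (t - p) (t + p)` supplies the other one. -/
theorem exists_coords (p : ℝ) (z : ℂ) :
    ∃ x : H3, x.u = p ∧ x.mat 0 1 = z ∧ x.t = Real.sqrt (1 + p ^ 2 + ‖z‖ ^ 2) := by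
  have hs : 0 ≤ 1 + p ^ 2 + ‖z‖ ^ 2 := by positivity
  have hq := Real.sq_sqrt hs
  have hd : 0 < Real.sqrt (1 + p ^ 2 + ‖z‖ ^ 2) - p := by
    have : |p| < Real.sqrt (1 + p ^ 2 + ‖z‖ ^ 2) := by
      apply Real.lt_sqrt_of_sq_lt
      rw [sq_abs]
      nlinarith [sq_nonneg ‖z‖]
    linarith [le_abs_self p]
  obtain ⟨x, hx⟩ := exists_mat_eq z hd
  have e : (1 + ‖z‖ ^ 2) / (Real.sqrt (1 + p ^ 2 + ‖z‖ ^ 2) - p) =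
      Real.sqrt (1 + p ^ 2 + ‖z‖ ^ 2) + p := by
    rw [div_eq_iff hd.ne']
    linear_combination -hq
  rw [e] at hx
  refine ⟨x, ?_, ?_, ?_⟩
  · simp only [u, hx, Matrix.of_apply, Matrix.cons_val', Matrix.cons_val_zero, Matrix.cons_val_one,
      Matrix.cons_val_fin_one, Complex.ofReal_re]
    ring
  · simp [hx]
  · simp only [t, hx, Matrix.of_apply, Matrix.cons_val', Matrix.cons_val_zero, Matrix.cons_val_one,
      Matrix.cons_val_fin_one, Complex.ofReal_re]
    ring

/-- The totally geodesic plane of all `x` with `Re (b x₁₀) = 0`. It contains the axis of the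
diagonal matrices. -/
def axialPlane (b : ℂ) : Set H3 := {x | (b * x.mat 1 0).re = 0}

/-- A Lipschitz map cannot send a null set onto a set of positive measure. Two linear coordinates on
the plane are Lipschitz on the disc, and their image contains a nonempty open subset of the
Euclidean plane. -/
theorem hausdorffMeasure_ball_inter_axialPlane_pos {b : ℂ} (hb : b ≠ 0) :
    0 < (μH[2] : Measure H3) (Metric.ball origin (1 / 2) ∩ axialPlane b) := by
  let f : H3 → Fin 2 → ℝ := fun x => ![x.u, (b * x.mat 1 0).im]
  set S : Set H3 := Metric.ball origin (1 / 2) ∩ axialPlane b with hS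
  let K : NNReal := ⟨3 * (1 + ‖b‖), by positivity⟩
  have hlip : LipschitzOnWith K f S := by
    refine LipschitzOnWith.of_dist_le_mul fun x hx y hy => ?_
    have h := coord_sq_le (x := x) (y := y) (by rw [dist_comm]; exact hx.1)
      (by rw [dist_comm]; exact hy.1)
    have h0 : 0 ≤ dist x y := dist_nonneg
    have hb0 := norm_nonneg b
    have hK : (K : ℝ) = 3 * (1 + ‖b‖) := rfl
    rw [dist_pi_le_iff (by positivity), Fin.forall_fin_two, hK]
    constructor
    · change |x.u - y.u| ≤ _
      have : |x.u - y.u| ≤ 3 * dist x y := abs_le_of_sq_le_sq (by nlinarith) (by positivity)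
      nlinarith [mul_nonneg hb0 h0]
    · change |(b * x.mat 1 0).im - (b * y.mat 1 0).im| ≤ _
      have e : (b * x.mat 1 0).im - (b * y.mat 1 0).im = (b * conj (x.mat 0 1 - y.mat 0 1)).im := by
        rw [map_sub, mul_sub, Complex.sub_im, mat_one_zero, mat_one_zero]
      have e2 : ‖x.mat 0 1 - y.mat 0 1‖ ≤ 3 * dist x y := by
        refine le_of_sq_le_sq ?_ (by positivity)
        rw [Complex.sq_norm, Complex.normSq_apply]
        have : (x.mat 0 1 - y.mat 0 1).re = x.v - y.v := rfl
        have : (x.mat 0 1 - y.mat 0 1).im = x.w - y.w := rfl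
        simp only [*]
        nlinarith
      rw [e]
      refine (Complex.abs_im_le_norm _).trans ?_
      rw [norm_mul, Complex.norm_conj]
      nlinarith [mul_le_mul_of_nonneg_left e2 hb0, mul_nonneg hb0 h0]
  let U : Set (Fin 2 → ℝ) := {q | 1 + q 0 ^ 2 + (q 1 / ‖b‖) ^ 2 < Real.cosh (1 / 2) ^ 2}
  have hU : IsOpen U := isOpen_lt (by fun_prop) continuous_const
  have hU0 : (0 : Fin 2 → ℝ) ∈ U := by
    have : 1 < Real.cosh (1 / 2) := Real.one_lt_cosh.mpr (by norm_num)
    change 1 + (0 : ℝ) ^ 2 + (0 / ‖b‖) ^ 2 < _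
    rw [zero_div]
    nlinarith
  have hUS : U ⊆ f '' S := by
    intro q hq
    have hbn : ‖b‖ ≠ 0 := norm_ne_zero_iff.mpr hb
    obtain ⟨x, hu, hz, ht⟩ := exists_coords (q 0) (conj (Complex.I * q 1 / b))
    have hbx : b * x.mat 1 0 = Complex.I * q 1 := by
      rw [mat_one_zero, hz, Complex.conj_conj]
      field_simp
    refine ⟨x, ⟨?_, ?_⟩, ?_⟩
    · rw [Metric.mem_ball', dist_origin_lt_half_iff, ht]
      rw [Real.sqrt_lt' (Real.cosh_pos _)]
      have : ‖conj (Complex.I * q 1 / b)‖ ^ 2 = (q 1 / ‖b‖) ^ 2 := by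
        rw [Complex.norm_conj, norm_div, norm_mul, Complex.norm_I, one_mul, Complex.norm_real,
          div_pow, div_pow, Real.norm_eq_abs, sq_abs]
      rw [this]
      exact hq
    · change (b * x.mat 1 0).re = 0
      rw [hbx]; simp
    · ext i
      fin_cases i
      · exact hu
      · change (b * x.mat 1 0).im = q 1
        rw [hbx]; simp
  have hpos : 0 < (μH[2] : Measure (Fin 2 → ℝ)) U := by
    have e : (μH[2] : Measure (Fin 2 → ℝ)) = volume := by
      have := hausdorffMeasure_pi_real (ι := Fin 2)
      simpa using this
    rw [e]
    exact hU.measure_pos _ ⟨0, hU0⟩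
  have hle := hlip.hausdorffMeasure_image_le (d := 2) (by norm_num)
  by_contra hcon
  rw [not_lt, nonpos_iff_eq_zero] at hcon
  rw [hcon, mul_zero] at hle
  exact absurd (measure_mono hUS |>.trans hle) (not_le.mpr hpos)

end H3

/-! ### Normal form of loxodromic elements -/

/-- The diagonal matrix with entries `a` and `a⁻¹`. -/
def diagSL : ℂˣ →* SL(2, ℂ) where
  toFun a := ⟨!![(a : ℂ), 0; 0, (a : ℂ)⁻¹], by rw [Matrix.det_fin_two_of]; simp⟩
  map_one' := by
    apply Subtype.ext
    ext i j
    fin_cases i <;> fin_cases j <;> simp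
  map_mul' a b := by
    apply Subtype.ext
    change !![((a * b : ℂˣ) : ℂ), 0; 0, ((a * b : ℂˣ) : ℂ)⁻¹] =
      !![(a : ℂ), 0; 0, (a : ℂ)⁻¹] * !![(b : ℂ), 0; 0, (b : ℂ)⁻¹]
    ext i j
    fin_cases i <;> fin_cases j <;> simp [Matrix.mul_apply, mul_comm]

theorem diagSL_coe (a : ℂˣ) : (diagSL a).1 = !![(a : ℂ), 0; 0, (a : ℂ)⁻¹] := rfl

/-- The roots of `X² - z X + 1` are mutually inverse. If they had modulus one they would be
conjugate, and `z` would be twice a real part, hence in `[-2, 2]`. -/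
theorem exists_eigenvalue_norm_gt_one {z : ℂ}
    (hz : ¬ ∃ r : ℝ, r ∈ Set.Icc (-2 : ℝ) 2 ∧ z = (r : ℂ)) :
    ∃ a : ℂˣ, 1 < ‖(a : ℂ)‖ ∧ (a : ℂ) + (a : ℂ)⁻¹ = z := by
  obtain ⟨s, hs⟩ := IsAlgClosed.exists_pow_nat_eq (z ^ 2 - 4) (n := 2) (by norm_num)
  have hl : ((z + s) / 2) * ((z - s) / 2) = 1 := by linear_combination -hs / 4
  have hl0 : (z + s) / 2 ≠ 0 := left_ne_zero_of_mul_eq_one hl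
  have hinv : ((z + s) / 2)⁻¹ = (z - s) / 2 := inv_eq_of_mul_eq_one_right hl
  have hsum : (z + s) / 2 + ((z + s) / 2)⁻¹ = z := by rw [hinv]; ring
  rcases lt_trichotomy 1 ‖(z + s) / 2‖ with h | h | h
  · exact ⟨Units.mk0 _ hl0, h, hsum⟩
  · exfalso
    apply hz
    set l := (z + s) / 2
    have hc : l⁻¹ = conj l := Complex.inv_eq_conj h.symm
    refine ⟨2 * l.re, ?_, ?_⟩
    · have := Complex.abs_re_le_norm l
      rw [← h, abs_le] at this
      constructor <;> linarith [this.1, this.2]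
    · rw [← hsum, hc, Complex.add_conj]
  · refine ⟨(Units.mk0 _ hl0)⁻¹, ?_, ?_⟩
    · rw [Units.val_inv_eq_inv_val, Units.val_mk0, norm_inv]
      exact (one_lt_inv₀ (norm_pos_iff.mpr hl0)).mpr h
    · rw [Units.val_inv_eq_inv_val, Units.val_mk0, inv_inv, add_comm, hsum]

theorem exists_eigenvector {M : SL(2, ℂ)} {a : ℂ} (ha : a ≠ 0) (h : a + a⁻¹ = M.1.trace) :
    ∃ v : Fin 2 → ℂ, v ≠ 0 ∧ M.1 *ᵥ v = a • v := by
  have hdet : (M.1 - a • (1 : Matrix (Fin 2) (Fin 2) ℂ)).det = 0 := by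
    have hM := M.2
    rw [Matrix.det_fin_two] at hM ⊢
    rw [Matrix.trace_fin_two] at h
    simp only [Matrix.sub_apply, Matrix.smul_apply, Matrix.one_apply_eq, smul_eq_mul, mul_one,
      ne_eq, zero_ne_one, one_ne_zero, not_false_eq_true, Matrix.one_apply_ne, mul_zero, sub_zero]
    have h2 : a * a⁻¹ = 1 := mul_inv_cancel₀ ha
    linear_combination hM + a * h - h2
  obtain ⟨v, hv, hv0⟩ := Matrix.exists_mulVec_eq_zero_iff.mpr hdet
  refine ⟨v, hv, ?_⟩
  rwa [Matrix.sub_mulVec, sub_eq_zero, Matrix.smul_mulVec, Matrix.one_mulVec] at hv0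

theorem exists_conj_diagSL {M : SL(2, ℂ)}
    (hM : ¬ ∃ r : ℝ, r ∈ Set.Icc (-2 : ℝ) 2 ∧ M.1.trace = (r : ℂ)) :
    ∃ (h : SL(2, ℂ)) (a : ℂˣ), 1 < ‖(a : ℂ)‖ ∧ M = h * diagSL a * h⁻¹ := by
  obtain ⟨a, ha, hsum⟩ := exists_eigenvalue_norm_gt_one hM
  obtain ⟨v, hv, hMv⟩ := exists_eigenvector a.ne_zero hsum
  obtain ⟨w, hw, hMw⟩ := exists_eigenvector (M := M) (inv_ne_zero a.ne_zero)
    (by rw [inv_inv, add_comm, hsum])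
  have hv0 := congrFun hMv 0
  have hv1 := congrFun hMv 1
  have hw0 := congrFun hMw 0
  have hw1 := congrFun hMw 1
  simp only [Matrix.mulVec, dotProduct, Fin.sum_univ_two, Pi.smul_apply, smul_eq_mul]
    at hv0 hv1 hw0 hw1
  have hne : (a : ℂ) - (a : ℂ)⁻¹ ≠ 0 := by
    intro h0
    have h1 := congrArg norm (sub_eq_zero.mp h0)
    rw [norm_inv] at h1
    have := inv_lt_one_of_one_lt₀ ha
    linarith
  -- Eigenvectors for the distinct eigenvalues `a` and `a⁻¹` are independent: if this determinant
  -- vanished, every product `v i * w j` would be killed by `a - a⁻¹`.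
  have hdet : v 0 * w 1 - v 1 * w 0 ≠ 0 := by
    intro hd
    have key : ∀ i j, v i * w j = 0 := by
      have k : ∀ i j, ((a : ℂ) - (a : ℂ)⁻¹) * (v i * w j) = 0 := by
        intro i j
        fin_cases i <;> fin_cases j
        all_goals simp only [Fin.zero_eta, Fin.mk_one, Fin.isValue]
        · linear_combination w 0 * (-hv0) + v 0 * hw0 - M.1 0 1 * hd
        · linear_combination w 1 * (-hv0) + v 1 * hw0 + (M.1 0 0 - (a : ℂ)⁻¹) * hd
        · linear_combination w 0 * (-hv1) + v 0 * hw1 - (M.1 1 1 - (a : ℂ)⁻¹) * hd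
        · linear_combination w 1 * (-hv1) + v 1 * hw1 + M.1 1 0 * hd
      exact fun i j => (mul_eq_zero.mp (k i j)).resolve_left hne
    apply hv
    ext i
    by_contra hi
    exact hw (funext fun j => (mul_eq_zero.mp (key i j)).resolve_left hi)
  set d := v 0 * w 1 - v 1 * w 0 with hd
  -- Dividing the first eigenvector by `d` makes the determinant one.
  let h : SL(2, ℂ) := ⟨!![v 0 / d, w 0; v 1 / d, w 1], by
    rw [Matrix.det_fin_two_of]; field_simp; rw [hd]; ring⟩
  refine ⟨h, a, ha, ?_⟩
  rw [eq_mul_inv_iff_mul_eq]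
  apply Subtype.ext
  change M.1 * h.1 = h.1 * (diagSL a).1
  rw [diagSL_coe]
  ext i j
  fin_cases i <;> fin_cases j <;>
    simp only [h, Matrix.mul_apply, Fin.sum_univ_two, Matrix.of_apply, Matrix.cons_val',
      Matrix.cons_val_zero, Matrix.cons_val_one, Matrix.cons_val_fin_one, Fin.zero_eta, Fin.mk_one,
      Fin.isValue, mul_zero, add_zero, zero_add]
  · linear_combination hv0 / d
  · linear_combination hw0
  · linear_combination hv1 / d
  · linear_combination hw1

/-! ### Diagonal matrices, their axis and the planes through it -/

namespace H3

/-- The factor `a⁻¹ * conj a` has modulus one: it is the rotational part of `diagSL a`, and it is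
trivial when `a` is real. -/
theorem diagSL_smul_apply_one_zero (a : ℂˣ) (x : H3) :
    (diagSL a • x).mat 1 0 = (a : ℂ)⁻¹ * conj (a : ℂ) * x.mat 1 0 := by
  rw [sl_smul_mat, diagSL_coe]
  simp [Matrix.mul_apply, Fin.sum_univ_two, Matrix.vecMul, dotProduct]
  ring

theorem diagSL_smul_origin_mat (a : ℂˣ) : (diagSL a • origin).mat =
    !![((‖(a : ℂ)‖ ^ 2 : ℝ) : ℂ), 0; 0, ((‖(a : ℂ)‖ ^ 2 : ℝ) : ℂ)⁻¹] := by
  have h : (a : ℂ) * conj (a : ℂ) = ((‖(a : ℂ)‖ ^ 2 : ℝ) : ℂ) := by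
    rw [Complex.mul_conj, Complex.sq_norm]
  rw [sl_smul_mat, diagSL_coe, ← h]
  ext i j
  fin_cases i <;> fin_cases j <;> simp [origin, Matrix.mul_apply, Fin.sum_univ_two, mul_comm]

theorem diagSL_smul_origin_congr {a b : ℂˣ} (h : ‖(a : ℂ)‖ = ‖(b : ℂ)‖) :
    diagSL a • origin = diagSL b • origin :=
  H3.ext (by rw [diagSL_smul_origin_mat, diagSL_smul_origin_mat, h])

/-- The unit `exp (s / 2)`. -/
def expHalf (s : ℝ) : ℂˣ := Units.mk0 (Real.exp (s / 2) : ℂ) (by exact_mod_cast Real.exp_ne_zero _)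

theorem norm_expHalf (s : ℝ) : ‖(expHalf s : ℂ)‖ = Real.exp (s / 2) := by
  simp only [expHalf, Units.val_mk0]
  rw [Complex.norm_real, Real.norm_eq_abs, Real.abs_exp]

/-- The unit speed geodesic of diagonal matrices. -/
def diagGeodesic (s : ℝ) : H3 := diagSL (expHalf s) • origin

theorem diagGeodesic_mat (s : ℝ) :
    (diagGeodesic s).mat = !![(Real.exp s : ℂ), 0; 0, (Real.exp (-s) : ℂ)] := by
  have h : Real.exp (s / 2) ^ 2 = Real.exp s := by
    rw [← Real.exp_nat_mul]; congr 1; push_cast; ring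
  rw [diagGeodesic, diagSL_smul_origin_mat, norm_expHalf, h, Real.exp_neg, Complex.ofReal_inv]

theorem isometry_diagGeodesic : Isometry diagGeodesic := by
  refine Isometry.of_dist_eq fun s s' => ?_
  have h : form (diagGeodesic s) (diagGeodesic s') = Real.cosh |s - s'| := by
    rw [form_eq, Real.cosh_abs, Real.cosh_eq]
    simp only [t, u, v, w, diagGeodesic_mat, Matrix.of_apply, Matrix.cons_val',
      Matrix.cons_val_zero, Matrix.cons_val_one, Matrix.cons_val_fin_one, Complex.ofReal_re,
      Complex.zero_re, Complex.zero_im]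
    rw [neg_sub, sub_eq_add_neg s, sub_eq_add_neg s', Real.exp_add, Real.exp_add]
    ring
  rw [dist_def, h, Real.arcosh_cosh (abs_nonneg _), Real.dist_eq]

/-- The rotational part of `diagSL a` fixes the geodesic pointwise, so only `‖a‖` matters and the
translation length is `2 log ‖a‖`. -/
theorem smul_diagGeodesic_mem_axis (h : SL(2, ℂ)) {a : ℂˣ} (ha : 1 < ‖(a : ℂ)‖) (s : ℝ) :
    h • diagGeodesic s ∈ axis (QuotientGroup.mk (h * diagSL a * h⁻¹) : PSL(2, ℂ)) := by
  refine ⟨fun s => h • diagGeodesic s, (isometry_smul H3 h).comp isometry_diagGeodesic,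
    ⟨s, rfl⟩, 2 * Real.log ‖(a : ℂ)‖, by have := Real.log_pos ha; linarith, fun s => ?_⟩
  change (h * diagSL a * h⁻¹) • h • diagGeodesic s = h • diagGeodesic _
  rw [mul_smul, mul_smul, inv_smul_smul, diagGeodesic, diagGeodesic, ← mul_smul (diagSL a),
    ← map_mul]
  congr 1
  apply diagSL_smul_origin_congr
  rw [Units.val_mul, norm_mul, norm_expHalf, norm_expHalf, add_div, Real.exp_add,
    mul_div_cancel_left₀ _ two_ne_zero, Real.exp_log (by linarith), mul_comm]

theorem smul_mem_hyperplane_iff {N : Matrix (Fin 2) (Fin 2) ℂ} (h : SL(2, ℂ)) (x : H3) :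
    (N * (h • x).mat).trace = 0 ↔ (((h.1)ᴴ * N * h.1) * x.mat).trace = 0 := by
  rw [sl_smul_mat, ← Matrix.mul_assoc, ← Matrix.mul_assoc, Matrix.trace_mul_comm,
    ← Matrix.mul_assoc, ← Matrix.mul_assoc]

theorem trace_mul_diagGeodesic (N : Matrix (Fin 2) (Fin 2) ℂ) (s : ℝ) :
    (N * (diagGeodesic s).mat).trace = N 0 0 * Real.exp s + N 1 1 * Real.exp (-s) := by
  rw [diagGeodesic_mat]
  simp [Matrix.trace_fin_two, Matrix.mul_apply, Fin.sum_univ_two]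

/-- A hyperplane that meets the geodesic `h • diagGeodesic` in two points is the image under `h`
of one of the planes `axialPlane b`. -/
theorem exists_mem_axialPlane_iff {P : Set H3} (hP : IsHyperplane P) (h : SL(2, ℂ)) {s s' : ℝ}
    (hss : s ≠ s') (hs : h • diagGeodesic s ∈ P) (hs' : h • diagGeodesic s' ∈ P) :
    ∃ b : ℂ, b ≠ 0 ∧ ∀ x, h • x ∈ P ↔ x ∈ axialPlane b := by
  obtain ⟨N, hN, hdet, rfl⟩ := hP
  set L := (h.1)ᴴ * N * h.1 with hL
  have hLH : L.IsHermitian := Matrix.isHermitian_conjTranspose_mul_mul _ hN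
  have hLdet : L.det.re < 0 := by
    rw [hL, Matrix.det_mul, Matrix.det_mul, Matrix.det_conjTranspose, h.2]
    simpa using hdet
  change (N * (h • diagGeodesic s).mat).trace = 0 at hs
  change (N * (h • diagGeodesic s').mat).trace = 0 at hs'
  rw [smul_mem_hyperplane_iff, trace_mul_diagGeodesic] at hs hs'
  have expand : ∀ r : ℝ, ((Real.exp r : ℝ) : ℂ) * ((Real.exp (-r) : ℝ) : ℂ) = 1 := fun r => by
    rw [← Complex.ofReal_mul, ← Real.exp_add]; simp
  -- The function `L 0 0 * exp r + L 1 1 * exp (-r)` of `r` vanishes at two distinct parameters, so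
  -- both coefficients are zero.
  have h00 : L 0 0 = 0 := by
    have hne : ((Real.exp s : ℝ) : ℂ) ^ 2 - ((Real.exp s' : ℝ) : ℂ) ^ 2 ≠ 0 := by
      rw [sub_ne_zero]
      intro he
      have he' : Real.exp s ^ 2 = Real.exp s' ^ 2 := by exact_mod_cast he
      rw [sq_eq_sq₀ (Real.exp_pos _).le (Real.exp_pos _).le] at he'
      exact hss (Real.exp_injective he')
    refine (mul_eq_zero.mp (?_ : _ * L 0 0 = 0)).resolve_left hne
    linear_combination Real.exp s * hs - Real.exp s' * hs' - L 1 1 * expand s + L 1 1 * expand s'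
  have h11 : L 1 1 = 0 := by
    linear_combination Real.exp s * hs - Real.exp s * Real.exp s * h00 - L 1 1 * expand s
  have h10 : L 1 0 = conj (L 0 1) := (hLH.apply 1 0).symm
  refine ⟨L 0 1, ?_, fun x => ?_⟩
  · intro h0
    rw [Matrix.det_fin_two, h00, h0] at hLdet
    simp at hLdet
  · change (N * (h • x).mat).trace = 0 ↔ (L 0 1 * x.mat 1 0).re = 0
    rw [smul_mem_hyperplane_iff, ← hL]
    have e : (L * x.mat).trace = ((2 * (L 0 1 * x.mat 1 0).re : ℝ) : ℂ) := by
      rw [← Complex.add_conj, map_mul, ← h10, mat_one_zero, Complex.conj_conj, Matrix.trace_fin_two,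
        Matrix.mul_apply, Matrix.mul_apply, Fin.sum_univ_two, Fin.sum_univ_two, h00, h11,
        mat_one_zero]
      ring
    rw [e, Complex.ofReal_eq_zero]
    simp

/-- If a diagonal matrix preserves an axial plane then the square of its eigenvalue is real. -/
theorem exists_sq_eq_ofReal {b : ℂ} (hb : b ≠ 0) {a : ℂˣ}
    (h : ∀ x ∈ axialPlane b, diagSL a • x ∈ axialPlane b) :
    ∃ r : ℝ, (a : ℂ) ^ 2 = r := by
  -- At a point of the plane with `b * x₁₀ = I`, staying in the plane says that the rotation factor
  -- `a⁻¹ * conj a` is a real number `r`; then `a² = ‖a‖² / r`.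
  obtain ⟨x, -, hx, -⟩ := exists_coords 0 (conj (Complex.I / b))
  have hx' : b * x.mat 1 0 = Complex.I := by
    rw [mat_one_zero, hx, Complex.conj_conj, mul_div_cancel₀ _ hb]
  have h1 : (b * (diagSL a • x).mat 1 0).re = 0 := h x (by
    change (b * x.mat 1 0).re = 0
    rw [hx']; simp)
  rw [diagSL_smul_apply_one_zero, mul_left_comm, hx', Complex.mul_I_re, neg_eq_zero] at h1
  obtain ⟨r, hr⟩ := Complex.conj_eq_iff_real.mp (Complex.conj_eq_iff_im.mpr h1)
  have ha : (a : ℂ) ≠ 0 := a.ne_zero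
  have hr0 : (r : ℂ) ≠ 0 := by
    rw [← hr]
    exact mul_ne_zero (inv_ne_zero ha) ((map_ne_zero _).mpr ha)
  refine ⟨‖(a : ℂ)‖ ^ 2 / r, ?_⟩
  rw [Complex.ofReal_div, eq_div_iff hr0, Complex.sq_norm, ← Complex.mul_conj, ← hr]
  field_simp

/-- Replacing `a` by `‖a‖` does not change the centre of the ball, and the diagonal matrix of a
positive real preserves every axial plane. The disc is therefore an isometric copy of the one at the
base point. -/
theorem hausdorffMeasure_ball_inter_eq {P : Set H3} {h : SL(2, ℂ)} {b : ℂ}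
    (hP : ∀ x, h • x ∈ P ↔ x ∈ axialPlane b) (a : ℂˣ) :
    (μH[2] : Measure H3) (Metric.ball (h • diagSL a • origin) (1 / 2) ∩ P) =
      (μH[2] : Measure H3) (Metric.ball origin (1 / 2) ∩ axialPlane b) := by
  let e : ℂˣ := Units.mk0 (‖(a : ℂ)‖ : ℂ) (by simp)
  have he : diagSL a • origin = diagSL e • origin := diagSL_smul_origin_congr (by simp [e])
  have hx : ∀ x, diagSL e • x ∈ axialPlane b ↔ x ∈ axialPlane b := fun x => by
    change (b * (diagSL e • x).mat 1 0).re = 0 ↔ (b * x.mat 1 0).re = 0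
    rw [diagSL_smul_apply_one_zero]
    simp [e]
  rw [he, ← mul_smul, ← hausdorffMeasure_smul (h * diagSL e)
    (Or.inl zero_le_two) (Metric.ball origin (1 / 2) ∩ axialPlane b), Set.smul_set_inter,
    Metric.smul_ball]
  congr 2
  ext y
  rw [Set.mem_smul_set_iff_inv_smul_mem, ← hx, ← hP, ← mul_smul, smul_inv_smul]

end H3

/-! ### From an invariant plane to a hyperbolic power -/

theorem isHyperbolic_conj_diagSL_sq (h : SL(2, ℂ)) {a : ℂˣ} (ha : 1 < ‖(a : ℂ)‖) {r : ℝ}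
    (hr : (a : ℂ) ^ 2 = r) :
    IsHyperbolic (QuotientGroup.mk (h * diagSL (a ^ 2) * h⁻¹) : PSL(2, ℂ)) := by
  refine ⟨_, rfl, r + r⁻¹, ?_, ?_⟩
  · have h1 : 1 < |r| := by
      rw [← Real.norm_eq_abs, ← Complex.norm_real, ← hr, norm_pow]
      exact one_lt_pow₀ ha two_ne_zero
    have h0 : r ≠ 0 := by rintro rfl; norm_num at h1
    intro hmem
    have h2 : |r + r⁻¹| ≤ 2 := abs_le.mpr hmem
    have h3 : |r + r⁻¹| * |r| = r ^ 2 + 1 := by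
      rw [← abs_mul, add_mul, inv_mul_cancel₀ h0, 
        abs_of_pos (by linarith [mul_self_nonneg r] : 0 < r * r + 1)]
      ring
    nlinarith [sq_abs r, mul_le_mul_of_nonneg_right h2 (abs_nonneg r)]
  · have e : (h * diagSL (a ^ 2) * h⁻¹ : SL(2, ℂ)).1.trace = (diagSL (a ^ 2)).1.trace := by
      change (h.1 * (diagSL (a ^ 2)).1 * (h⁻¹ : SL(2, ℂ)).1).trace = _
      rw [Matrix.trace_mul_comm, ← Matrix.mul_assoc]
      change ((h⁻¹ * h : SL(2, ℂ)).1 * _).trace = _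
      rw [inv_mul_cancel]
      change ((1 : Matrix (Fin 2) (Fin 2) ℂ) * _).trace = _
      rw [Matrix.one_mul]
    rw [e, diagSL_coe, Matrix.trace_fin_two_of, Units.val_pow_eq_pow_val, hr]
    push_cast
    rfl

theorem conj_diagSL_pow (h : SL(2, ℂ)) (a : ℂˣ) (n : ℕ) :
    (h * diagSL a * h⁻¹) ^ n = h * diagSL (a ^ n) * h⁻¹ := by
  rw [conj_pow, map_pow]

/-- A loxodromic element of a discrete group has a hyperbolic power if two points of its axis lie in
a finite area hyperplane. -/
theorem exists_isHyperbolic_pow {Γ : Subgroup PSL(2, ℂ)} [DiscreteTopology Γ] {P : Set H3}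
    (hP : IsHyperplane P) (hPfin : HasFiniteArea Γ P) (h : SL(2, ℂ)) {a : ℂˣ}
    (ha : 1 < ‖(a : ℂ)‖) (hΓ : (QuotientGroup.mk (h * diagSL a * h⁻¹) : PSL(2, ℂ)) ∈ Γ) {s s' : ℝ}
    (hss : s ≠ s') (hs : h • H3.diagGeodesic s ∈ P) (hs' : h • H3.diagGeodesic s' ∈ P) :
    ∃ n : ℕ, 1 ≤ n ∧
      IsHyperbolic ((QuotientGroup.mk (h * diagSL a * h⁻¹) : PSL(2, ℂ)) ^ n) := by
  obtain ⟨b, hb, hPb⟩ := H3.exists_mem_axialPlane_iff hP h hss hs hs'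
  obtain ⟨F, hF, hFfin⟩ := hPfin
  have := H3.countable_of_discrete Γ
  have hpow : ∀ n : ℕ, ∀ x : H3, (⟨_, hΓ⟩ : Γ) ^ n • h • x = h • diagSL (a ^ n) • x := by
    intro n x
    change (h * diagSL a * h⁻¹) ^ n • h • x = _
    rw [conj_diagSL_pow, mul_smul, mul_smul, inv_smul_smul]
  obtain ⟨n, hn, hnP⟩ := H3.exists_pow_smul_eq_of_finite_area hF hFfin ⟨_, hΓ⟩ (h • H3.origin)
    (H3.finite_setOf_dist_smul_le Γ h 1) (H3.hausdorffMeasure_ball_inter_axialPlane_pos hb).ne'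
    (fun n => by
      have e : ((⟨_, hΓ⟩ : Γ) ^ n)⁻¹ • h • H3.origin = h • diagSL (a ^ n)⁻¹ • H3.origin := by
        rw [inv_smul_eq_iff, hpow, ← mul_smul (diagSL _), ← map_mul, mul_inv_cancel, map_one,
          one_smul]
      rw [e, H3.hausdorffMeasure_ball_inter_eq hPb])
  obtain ⟨r, hr⟩ := H3.exists_sq_eq_ofReal hb (a := a ^ n) fun x hx => by
    rw [← hPb, ← hpow, ← hnP]
    exact Set.smul_mem_smul_set ((hPb x).mpr hx)
  -- The exponent is doubled because `γ ^ n` may turn by `π` around its axis, exchanging the sides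
  -- of `P`; then `a ^ n` is purely imaginary, and only its square is real.
  refine ⟨n * 2, by omega, ?_⟩
  have ha' : 1 < ‖((a ^ n : ℂˣ) : ℂ)‖ := by
    rw [Units.val_pow_eq_pow_val, norm_pow]
    exact one_lt_pow₀ ha (by omega)
  have e : (QuotientGroup.mk (h * diagSL a * h⁻¹) : PSL(2, ℂ)) ^ (n * 2) =
      QuotientGroup.mk (h * diagSL ((a ^ n) ^ 2) * h⁻¹) := by
    rw [← pow_mul, ← conj_diagSL_pow]; rfl
  rw [e]
  exact isHyperbolic_conj_diagSL_sq h ha' hr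

theorem IsHyperbolic.of_conj {g γ : PSL(2, ℂ)} (h : IsHyperbolic (g * γ * g⁻¹)) :
    IsHyperbolic γ := by
  obtain ⟨M, hM, r, hr, htr⟩ := h
  induction g using QuotientGroup.induction_on with
  | H A =>
    refine ⟨A⁻¹ * M * A, ?_, r, hr, ?_⟩
    · change (QuotientGroup.mk A : PSL(2, ℂ))⁻¹ * QuotientGroup.mk M * QuotientGroup.mk A = γ
      rw [hM]
      group
    · rw [← htr]
      change ((A⁻¹ : SL(2, ℂ)).1 * M.1 * A.1).trace = _
      rw [Matrix.trace_mul_comm, ← Matrix.mul_assoc]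
      change ((A * A⁻¹ : SL(2, ℂ)).1 * M.1).trace = _
      rw [mul_inv_cancel]
      change ((1 : Matrix (Fin 2) (Fin 2) ℂ) * M.1).trace = _
      rw [Matrix.one_mul]

theorem exists_smul_mem_of_proj_mem {Γ : Subgroup PSL(2, ℂ)} {P : Set H3} {x : H3}
    (hx : proj Γ x ∈ proj Γ '' P) : ∃ g : Γ, g • x ∈ P := by
  obtain ⟨y, hy, hyx⟩ := hx
  obtain ⟨g, hg⟩ := MulAction.orbitRel_apply.mp (Quotient.exact hyx)
  exact ⟨g, by rw [show g • x = y from hg]; exact hy⟩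

end HypGeod

end

theorem mainTheorem6 (Γ : Subgroup (Matrix.ProjectiveSpecialLinearGroup (Fin 2) ℂ))
    (hΓ : HypGeod.IsArithmeticKleinian Γ)
    (γ : Matrix.ProjectiveSpecialLinearGroup (Fin 2) ℂ) (hγ : γ ∈ Γ)
    (hlox : HypGeod.IsLoxodromic γ)
    (hpow : ¬ ∃ n : ℕ, 1 ≤ n ∧ HypGeod.IsHyperbolic (γ ^ n)) :
    ¬ ∃ S : Set (HypGeod.Orbifold Γ), HypGeod.IsFiniteAreaTotallyGeodesicSurface Γ S ∧
      HypGeod.associatedGeodesic Γ γ ⊆ S := by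
  rintro ⟨S, ⟨P, hP, hPfin, rfl⟩, hsub⟩
  apply hpow
  have hdisc : DiscreteTopology Γ := hΓ.1.1
  have hcount := HypGeod.H3.countable_of_discrete Γ
  obtain ⟨M, rfl, hM⟩ := hlox
  obtain ⟨h, a, ha, rfl⟩ := HypGeod.exists_conj_diagSL hM
  have hex : ∀ s : ℝ, ∃ g : Γ, g • h • HypGeod.H3.diagGeodesic s ∈ P := fun s =>
    HypGeod.exists_smul_mem_of_proj_mem
      (hsub ⟨_, HypGeod.H3.smul_diagGeodesic_mem_axis h ha s, rfl⟩)
  choose f hf using hex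
  -- Pigeonhole: a map from the uncountable line to the countable group `Γ` is not injective.
  obtain ⟨s, s', hfs, hss⟩ : ∃ s s', f s = f s' ∧ s ≠ s' := by
    by_contra! hinj
    exact not_countable (α := ℝ) (Function.Injective.countable (f := f) fun s s' => hinj s s')
  have hs := hf s
  have hs' := hf s'
  rw [← hfs] at hs'
  obtain ⟨⟨g, hg⟩, hgf⟩ : ∃ g, g = f s := ⟨_, rfl⟩
  rw [← hgf] at hs hs'
  induction g using QuotientGroup.induction_on with
  | H A =>
    have e : (QuotientGroup.mk (A * h * HypGeod.diagSL a * (A * h)⁻¹) :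
        Matrix.ProjectiveSpecialLinearGroup (Fin 2) ℂ) =
        QuotientGroup.mk A * QuotientGroup.mk (h * HypGeod.diagSL a * h⁻¹) *
          (QuotientGroup.mk A)⁻¹ := by
      rw [← QuotientGroup.mk_inv, ← QuotientGroup.mk_mul, ← QuotientGroup.mk_mul]
      congr 1
      group
    obtain ⟨n, hn, hhyp⟩ := HypGeod.exists_isHyperbolic_pow hP hPfin (A * h) ha
      (e ▸ Γ.mul_mem (Γ.mul_mem hg hγ) (Γ.inv_mem hg)) hss
      (by rw [mul_smul]; exact hs) (by rw [mul_smul]; exact hs')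
    rw [e, conj_pow] at hhyp
    exact ⟨n, hn, hhyp.of_conj⟩
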